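/- Let $G=(V,E)$ be a finite simple undirected graph with $n=|V|$ vertices and no isolated vertices, and let $d_i\ge 1$ denote the degree of $i\in V$. For $x\in\mathbb{R}^V$ put $$I^+(x)=\sum_{\{i,j\}\in E}|x_i+x_j|,\qquad \|x\|=\sum_{i\in V}d_i|x_i|,\qquad X=\{x\in\mathbb{R}^V:\|x\|=1\}.$$ For a centrally symmetric set $A\subseteq\mathbb{R}^V\setminus\{0\}$ let $\gamma(A)$ be its Krasnoselskii genus, that is, the least integer $m\ge 0$ for which there is an odd continuous map $A\to\mathbb{R}^m\setminus\{0\}$ (with $\gamma(\emptyset)=0$, and $\gamma(A)=\infty$ if there is no such $m$). For $k=1,\dots,n$ let $$c_k=\inf_{\gamma(A)\ge k}\ \sup_{x\in A} I^+(x),$$ where $A$ ranges over the compact centrally symmetric subsets of $X$ with $\gamma(A)\ge k$, be the $k$-th min-max eigenvalue of the signless $1$-Laplacian $\Delta_1^+$. Let $\lambda_1\le\lambda_2\le\dots\le\lambda_n$ be the eigenvalues, counted with multiplicity, of the normalized Laplacian $\Delta_2=D^{-1/2}(D-A_G)D^{-1/2}$ of $G$, where $D=\mathrm{diag}(d_i)$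 and $A_G$ is the adjacency matrix. Then, for every $k=1,\dots,n$, $$\frac{c_k^2}{2}\le 2-\lambda_{n-k+1}\le 2c_k.$$ -/

import Mathlib

namespace SignlessOneLaplacian

open scoped Matrix

/-- The Krasnoselskii genus of a centrally symmetric set `A`: the least `m` such that there is an
odd continuous map from `A` to `ℝᵐ ∖ {0}`, and `⊤` if there is no such `m`.
(For `m = 0` such a map exists only if `A` is empty.) -/
noncomputable def genus {E : Type*} [TopologicalSpace E] [Neg E] (A : Set E) : ℕ∞ :=
  ⨅ (m : ℕ) (_ : ∃ f : E → (Fin m → ℝ), ContinuousOn f A ∧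
      (∀ x ∈ A, f (-x) = -f x) ∧ ∀ x ∈ A, f x ≠ 0), (m : ℕ∞)

section Graph

variable {V : Type*} [Fintype V] [DecidableEq V] (G : SimpleGraph V) [DecidableRel G.Adj]

/-- `I⁺(x) = ∑_{{i,j} ∈ E} |x_i + x_j|`. -/
noncomputable def signlessTV (x : V → ℝ) : ℝ :=
  ∑ e ∈ G.edgeFinset, Sym2.lift ⟨fun i j => |x i + x j|, fun i j => by simp only [add_comm]⟩ e

/-- `‖x‖ = ∑_{i ∈ V} d_i |x_i|`. -/
noncomputable def degreeNorm (x : V → ℝ) : ℝ :=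
  ∑ i, (G.degree i : ℝ) * |x i|

/-- The unit sphere `X = {x : ∑_i d_i |x_i| = 1}`. -/
def unitSphere : Set (V → ℝ) := {x | degreeNorm G x = 1}

/-- The compact centrally symmetric subsets of `X` of genus at least `k`. -/
def admissible (k : ℕ) : Set (Set (V → ℝ)) :=
  {A | A ⊆ unitSphere G ∧ IsCompact A ∧ (∀ x ∈ A, -x ∈ A) ∧ (k : ℕ∞) ≤ genus A}

/-- The `k`-th min-max eigenvalue (`k = 1, …, n`) of the signless 1-Laplacian `Δ₁⁺`,
`c_k = inf_{γ(A) ≥ k} sup_{x ∈ A} I⁺(x)`, where `A` ranges over the compact centrally symmetric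
subsets of `X`. -/
noncomputable def minMaxEigenvalue (k : ℕ) : ℝ :=
  sInf ((fun A => sSup (signlessTV G '' A)) '' admissible G k)

/-- The normalized Laplacian `Δ₂ = D^{-1/2} (D - A) D^{-1/2}`. -/
noncomputable def normalizedLaplacian : Matrix V V ℝ :=
  Matrix.diagonal (fun v => (Real.sqrt (G.degree v))⁻¹) * G.lapMatrix ℝ *
    Matrix.diagonal (fun v => (Real.sqrt (G.degree v))⁻¹)

theorem normalizedLaplacian_isHermitian : (normalizedLaplacian G).IsHermitian := by
  have h : (Matrix.diagonal fun v => (Real.sqrt (G.degree v))⁻¹)ᴴ =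
      Matrix.diagonal (fun v => (Real.sqrt (G.degree v))⁻¹) := by
    simp
  have h2 := Matrix.isHermitian_mul_mul_conjTranspose
    (Matrix.diagonal fun v => (Real.sqrt (G.degree v))⁻¹)
    (show (G.lapMatrix ℝ).IsHermitian from by
      simpa [Matrix.IsHermitian, Matrix.IsSymm] using G.isSymm_lapMatrix (R := ℝ))
  rwa [h] at h2

/-- `λ_j`, the `j`-th smallest eigenvalue of `Δ₂`, counted with multiplicity, for `1 ≤ j ≤ n`
(and `0` for other `j`). Mathlib's `eigenvalues₀` lists the eigenvalues in decreasing order,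
starting with the index `0`, so the `j`-th smallest one has the index `n - j`. -/
noncomputable def laplacianEigenvalue (j : ℕ) : ℝ :=
  if h : 1 ≤ j ∧ j ≤ Fintype.card V then
    (normalizedLaplacian_isHermitian G).eigenvalues₀ ⟨Fintype.card V - j, by omega⟩
  else 0

end Graph

end SignlessOneLaplacian

/-! Let μ_k = 2 - λ_{n-k+1}, the k-th smallest eigenvalue of 2 - Δ₂, with eigenvectors u_a, and let
Q(y) = ∑_{ij∈E} (y_i + y_j)². Then Q(y) = ∑ μ_a ⟨u_a, D^{1/2}y⟩² (`signlessForm_eq_sum`). The odd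
homeomorphism y_i ↦ y_i|y_i|, with inverse `oddSqrt`, carries the sphere ∑ d_i y_i² = 1 onto X, and
both bounds compare Q with I⁺ along it.

For μ_k ≤ 2c_k: Q(oddSqrt x) ≤ 2I⁺(x), and if γ(A) ≥ k, the first k - 1 coefficients of oddSqrt x
vanish together at some x ∈ A, where Q ≥ μ_k.

For c_k² ≤ 2μ_k: Cauchy–Schwarz gives I⁺(y|y|)² ≤ 2Q(y) on the sphere, and Q ≤ μ_k on its part
spanned by the first k eigenvectors. The image of that part has genus at least k by Borsuk–Ulam.

Borsuk–Ulam is proved with mod 2 cochains on tuples of points. The sign bits s_j of the coordinates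
of an odd map satisfy s_j(-x) = s_j(x) + 1, and induction on dimension shows that δs_{i-1} ⌣ ⋯ ⌣
δs_0 takes the value 1 on a finely subdivided hemisphere. Hence every coordinate changes sign on one
tiny simplex, where the map is therefore small; compactness yields a zero. -/

namespace SignlessOneLaplacian

/-! ### Mod 2 cochains on tuples: prisms and cup products -/

section Cochains

variable {X : Type*}

/-- The simplicial coboundary, with coefficients mod 2, of a function on lists of points. -/
def coboundary : (List X → ZMod 2) → List X → ZMod 2
  | _, [] => 0
  | F, a :: l => F l + coboundary (fun m => F (a :: m)) l

/-- The prism operator (mod 2) of a pair of maps. -/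
def prism {Y : Type*} (g g' : X → Y) : (List Y → ZMod 2) → List X → ZMod 2
  | _, [] => 0
  | F, a :: l => F (g a :: g' a :: l.map g') + prism g g' (fun m => F (g a :: m)) l

theorem coboundary_add (F F' : List X → ZMod 2) (l : List X) :
    coboundary (fun m => F m + F' m) l = coboundary F l + coboundary F' l := by
  induction l generalizing F F' with
  | nil => simp [coboundary]
  | cons a l ih => simp only [coboundary, ih]; ring

theorem coboundary_const_mul (c : ZMod 2) (F : List X → ZMod 2) (l : List X) :
    coboundary (fun m => c * F m) l = c * coboundary F l := by
  induction l generalizing F with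
  | nil => simp [coboundary]
  | cons a l ih => simp only [coboundary, ih]; ring

theorem prism_add {Y : Type*} (g g' : X → Y) (F F' : List Y → ZMod 2) (l : List X) :
    prism g g' (fun m => F m + F' m) l = prism g g' F l + prism g g' F' l := by
  induction l generalizing F F' with
  | nil => simp [prism]
  | cons a l ih => simp only [prism, ih]; ring

theorem coboundary_map {Y : Type*} (g : X → Y) (F : List Y → ZMod 2) (l : List X) :
    coboundary (fun m => F (m.map g)) l = coboundary F (l.map g) := by
  induction l generalizing F with
  | nil => simp [coboundary]
  | cons a l ih =>
    simp only [coboundary, List.map_cons, ih (fun m => F (g a :: m))]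

/-- Homotopy formula: the interior faces of the prism cancel in pairs mod 2, leaving its two ends.
-/
theorem prism_coboundary {Y : Type*} (g g' : X → Y) (F : List Y → ZMod 2) (l : List X) :
    prism g g' (coboundary F) l + coboundary (prism g g' F) l =
      F (l.map g') + F (l.map g) := by
  induction l generalizing F with
  | nil => simp [prism, coboundary, CharTwo.add_self_eq_zero]
  | cons a l ih =>
    have h := ih (fun m => F (g a :: m))
    simp only [prism, coboundary, List.map_cons, coboundary_add, prism_add] at h ⊢
    rw [coboundary_map g' (fun m => F (g a :: g' a :: m))]
    have e : ∀ a b c d p q r : ZMod 2, q + p = b + r →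
        a + (b + c) + (d + q) + (d + (c + p)) = a + r := by decide
    exact e _ _ _ _ _ _ _ h

theorem prism_eq_zero {Y : Type*} (g g' : X → Y) (F : List Y → ZMod 2) (l : List X)
    (hF : ∀ m : List Y, m.length = l.length + 1 →
      (∀ y ∈ m, ∃ x ∈ l, y = g x ∨ y = g' x) → F m = 0) :
    prism g g' F l = 0 := by
  induction l generalizing F with
  | nil => rfl
  | cons a l ih =>
    rw [prism, hF, ih, add_zero]
    · intro m hm h
      refine hF _ (by simp [hm]) ?_
      intro y hy
      rcases List.mem_cons.1 hy with rfl | hy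
      · exact ⟨a, by simp, Or.inl rfl⟩
      · obtain ⟨x, hx, h'⟩ := h y hy
        exact ⟨x, by simp [hx], h'⟩
    · simp
    · intro y hy
      simp only [List.mem_cons, List.mem_map] at hy
      rcases hy with rfl | rfl | ⟨x, hx, rfl⟩
      · exact ⟨a, by simp, Or.inl rfl⟩
      · exact ⟨a, by simp, Or.inr rfl⟩
      · exact ⟨x, by simp [hx], Or.inr rfl⟩

/-- The cup product `δs_{i-1} ⌣ ⋯ ⌣ δs_0` of the coboundaries of functions `s_j`. -/
def cupCoboundary (s : ℕ → X → ZMod 2) : List X → ZMod 2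
  | [] => 0
  | [_] => 1
  | a :: b :: l => (s l.length a + s l.length b) * cupCoboundary s (b :: l)

/-- The cup product `s_i ⌣ δs_{i-1} ⌣ ⋯ ⌣ δs_0`. -/
def cupPrimitive (s : ℕ → X → ZMod 2) : List X → ZMod 2
  | [] => 1
  | a :: l => s l.length a * cupCoboundary s (a :: l)

theorem coboundary_congr {F F' : List X → ZMod 2} {l : List X}
    (h : ∀ m : List X, m.length + 1 = l.length → F m = F' m) :
    coboundary F l = coboundary F' l := by
  induction l generalizing F F' with
  | nil => rfl
  | cons a l ih =>
    rw [coboundary, coboundary, h l rfl, ih]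
    intro m hm
    exact h _ (by simp [hm])

/-- The truncated index at `l = []` is harmless because `cupCoboundary s [] = 0`. -/
theorem cupCoboundary_cons (s : ℕ → X → ZMod 2) (a : X) (l : List X) :
    cupCoboundary s (a :: l) = s (l.length - 1) a * cupCoboundary s l + cupPrimitive s l := by
  cases l with
  | nil => simp [cupCoboundary, cupPrimitive]
  | cons b l => simp [cupCoboundary, cupPrimitive]; ring

/-- The identities are proved together: the faces that keep the head `a` contribute s(a)·δ(cup) +
δ(primitive) of the tail, which needs both. -/
theorem coboundary_cup (s : ℕ → X → ZMod 2) (l : List X) :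
    coboundary (cupCoboundary s) l = 0 ∧
      coboundary (cupPrimitive s) l = cupCoboundary s l := by
  induction l with
  | nil => simp [coboundary, cupCoboundary]
  | cons a l ih =>
    obtain ⟨ih₁, ih₂⟩ := ih
    have h₁ : coboundary (fun m => cupCoboundary s (a :: m)) l = cupCoboundary s l := by
      rw [coboundary_congr (F' := fun m => s (l.length - 2) a * cupCoboundary s m +
        cupPrimitive s m), coboundary_add, coboundary_const_mul, ih₁, ih₂, mul_zero, zero_add]
      intro m hm
      rw [cupCoboundary_cons, ← hm]
      rfl
    refine ⟨by rw [coboundary, h₁, CharTwo.add_self_eq_zero], ?_⟩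
    rw [coboundary, cupCoboundary_cons, add_comm]
    congr 1
    rw [coboundary_congr (F' := fun m => s (l.length - 1) a * cupCoboundary s (a :: m)),
      coboundary_const_mul, h₁]
    intro m hm
    rw [cupPrimitive, ← hm]
    rfl

theorem exists_ne_of_cupCoboundary_ne_zero (s : ℕ → X → ZMod 2) (l : List X)
    (h : cupCoboundary s l ≠ 0) (j : ℕ) (hj : j + 1 < l.length) :
    ∃ a ∈ l, ∃ b ∈ l, s j a ≠ s j b := by
  induction l with
  | nil => simp at hj
  | cons a l ih =>
    cases l with
    | nil => simp at hj
    | cons b l =>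
      rw [cupCoboundary] at h
      rcases Nat.lt_succ_iff_lt_or_eq.1 (Nat.lt_of_succ_lt_succ hj) with h' | h'
      · obtain ⟨x, hx, y, hy, hxy⟩ := ih (right_ne_zero_of_mul h) (by simpa using h')
        exact ⟨x, by simp [hx], y, by simp [hy], hxy⟩
      · refine ⟨a, by simp, b, by simp, fun hab => left_ne_zero_of_mul h ?_⟩
        rw [← show j = l.length by simpa using h', hab, CharTwo.add_self_eq_zero]

end Cochains

/-! ### Hemispheres as iterated joins, and their boundaries -/

section BorsukUlam

variable {E : Type*} [AddCommGroup E] [Module ℝ E]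

/-- The segment from `x` to `w`, as a function of the time `t`. -/
def coneMap (w : E) (t : ℝ) (x : E) : E := (1 - t) • x + t • w

theorem coneMap_zero (w : E) : coneMap w 0 = id := by
  ext x; simp [coneMap]

theorem coneMap_one_neg (w x : E) : coneMap w 1 (-x) = coneMap w 1 x := by
  simp [coneMap]

/-- The evaluation of cochains on the sphere made of a hemisphere and its antipode. -/
def doubled (H : (List E → ZMod 2) → ZMod 2) (F : List E → ZMod 2) : ZMod 2 :=
  H F + H (fun l => F (l.map Neg.neg))

/-- The evaluation of cochains on the upper hemisphere of dimension `i`, which is obtained by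
joining the sphere of dimension `i - 1` with the point `v i` in `N` steps. -/
noncomputable def hemisphere (v : ℕ → E) (N : ℕ) : ℕ → (List E → ZMod 2) → ZMod 2
  | 0, F => F [v 0]
  | i + 1, F => ∑ j ∈ Finset.range N, doubled (hemisphere v N i) (fun l =>
      prism (coneMap (v (i + 1)) (j / N)) (coneMap (v (i + 1)) ((j + 1 : ℕ) / N)) F l)

theorem hemisphere_add (v : ℕ → E) (N i : ℕ) (F F' : List E → ZMod 2) :
    hemisphere v N i (fun l => F l + F' l) = hemisphere v N i F + hemisphere v N i F' := by
  induction i generalizing F F' with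
  | zero => rfl
  | succ i ih =>
    simp only [hemisphere, ← Finset.sum_add_distrib]
    refine Finset.sum_congr rfl fun j _ => ?_
    simp only [doubled, prism_add, ih]
    ring

theorem doubled_hemisphere_add (v : ℕ → E) (N i : ℕ) (F F' : List E → ZMod 2) :
    doubled (hemisphere v N i) (fun l => F l + F' l) =
      doubled (hemisphere v N i) F + doubled (hemisphere v N i) F' := by
  simp only [doubled, hemisphere_add]
  ring

theorem hemisphere_zero_coboundary (v : ℕ → E) (N : ℕ) (F : List E → ZMod 2) :
    hemisphere v N 0 (coboundary F) = F [] := by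
  simp [hemisphere, coboundary]

/-- The time slabs telescope. At time 1 the cone has collapsed to its apex, where antipodal
contributions cancel mod 2; at time 0 it is the identity. -/
theorem hemisphere_succ_coboundary_of_cycle (v : ℕ → E) {N : ℕ} (hN : N ≠ 0) (i : ℕ)
    (hi : ∀ F, doubled (hemisphere v N i) (coboundary F) = 0) (F : List E → ZMod 2) :
    hemisphere v N (i + 1) (coboundary F) = doubled (hemisphere v N i) F := by
  set a : ℕ → ZMod 2 := fun j =>
    doubled (hemisphere v N i) (fun l => F (l.map (coneMap (v (i + 1)) (j / N)))) with ha
  have h₁ : ∀ j ∈ Finset.range N, doubled (hemisphere v N i) (fun l =>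
      prism (coneMap (v (i + 1)) (j / N)) (coneMap (v (i + 1)) ((j + 1 : ℕ) / N))
        (coboundary F) l) = a (j + 1) - a j := by
    intro j _
    have h : (fun l => prism (coneMap (v (i + 1)) (j / N))
        (coneMap (v (i + 1)) ((j + 1 : ℕ) / N)) (coboundary F) l) =
        fun l => (F (l.map (coneMap (v (i + 1)) ((j + 1 : ℕ) / N))) +
          F (l.map (coneMap (v (i + 1)) (j / N)))) + coboundary (prism
            (coneMap (v (i + 1)) (j / N)) (coneMap (v (i + 1)) ((j + 1 : ℕ) / N)) F) l := by
      funext l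
      rw [← prism_coboundary, add_assoc, CharTwo.add_self_eq_zero, add_zero]
    rw [h, doubled_hemisphere_add, hi, add_zero, doubled_hemisphere_add, CharTwo.sub_eq_add]
  have h₂ : a N = 0 := by
    have : (N : ℝ) / N = 1 := div_self (by exact_mod_cast hN)
    simp only [ha, this, doubled, List.map_map]
    have h : coneMap (v (i + 1)) 1 ∘ Neg.neg = coneMap (v (i + 1)) 1 :=
      funext (coneMap_one_neg _)
    rw [h]
    exact CharTwo.add_self_eq_zero _
  have h₃ : a 0 = doubled (hemisphere v N i) F := by
    simp only [ha, Nat.cast_zero, zero_div, coneMap_zero, List.map_id]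
  rw [hemisphere, Finset.sum_congr rfl h₁, Finset.sum_range_sub, h₂, h₃, CharTwo.sub_eq_add,
    zero_add]

theorem doubled_hemisphere_coboundary (v : ℕ → E) {N : ℕ} (hN : N ≠ 0) (i : ℕ)
    (F : List E → ZMod 2) : doubled (hemisphere v N i) (coboundary F) = 0 := by
  induction i generalizing F with
  | zero =>
    rw [doubled, ← funext fun l => coboundary_map Neg.neg F l, hemisphere_zero_coboundary,
      hemisphere_zero_coboundary]
    exact CharTwo.add_self_eq_zero _
  | succ i ih =>
    rw [doubled, ← funext fun l => coboundary_map Neg.neg F l,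
      hemisphere_succ_coboundary_of_cycle v hN i ih,
      hemisphere_succ_coboundary_of_cycle v hN i ih, doubled, doubled]
    simp only [List.map_map, neg_comp_neg, List.map_id]
    rw [add_comm (hemisphere v N i fun l => F (l.map Neg.neg))]
    exact CharTwo.add_self_eq_zero _

theorem hemisphere_succ_coboundary (v : ℕ → E) {N : ℕ} (hN : N ≠ 0) (i : ℕ)
    (F : List E → ZMod 2) :
    hemisphere v N (i + 1) (coboundary F) = doubled (hemisphere v N i) F :=
  hemisphere_succ_coboundary_of_cycle v hN i (doubled_hemisphere_coboundary v hN i) F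

end BorsukUlam

/-! ### Small simplices and the evaluation of the cup product -/

section Small

variable {E : Type*} [NormedAddCommGroup E] [NormedSpace ℝ E]

theorem norm_coneMap_sub_coneMap_le {w x y : E} {t t' : ℝ} (ht : 0 ≤ t) (ht' : t ≤ 1)
    (hw : ‖w‖ ≤ 1) (hy : ‖y‖ ≤ 1) :
    ‖coneMap w t x - coneMap w t' y‖ ≤ ‖x - y‖ + 2 * |t - t'| := by
  have h : coneMap w t x - coneMap w t' y = (1 - t) • (x - y) + (t - t') • (w - y) := by
    simp only [coneMap]; module
  rw [h]
  refine (norm_add_le _ _).trans ?_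
  rw [norm_smul, norm_smul, Real.norm_eq_abs, Real.norm_eq_abs, abs_of_nonneg (by linarith)]
  have h₁ : ‖w - y‖ ≤ 2 := (norm_sub_le _ _).trans (by linarith)
  have h₂ := mul_le_mul_of_nonneg_left h₁ (abs_nonneg (t - t'))
  nlinarith [norm_nonneg (x - y)]

/-- Each join adds at most 2/N to the distance between vertices, whence 2i/N in dimension i. -/
theorem hemisphere_eq_zero {v : ℕ → E} {N n : ℕ} (hN : N ≠ 0) {S : ℕ → Set E}
    (h0 : v 0 ∈ S 0) (hneg : ∀ i, ∀ x ∈ S i, -x ∈ S i) (hv : ∀ i, ‖v i‖ ≤ 1)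
    (hS : ∀ i, ∀ x ∈ S i, ‖x‖ ≤ 1)
    (hcone : ∀ i < n, ∀ t : ℝ, 0 ≤ t → t ≤ 1 → ∀ x ∈ S i, coneMap (v (i + 1)) t x ∈ S (i + 1))
    (i : ℕ) (hi : i ≤ n) (F : List E → ZMod 2)
    (hF : ∀ l : List E, l.length = i + 1 → (∀ x ∈ l, x ∈ S i) →
      (∀ x ∈ l, ∀ y ∈ l, ‖x - y‖ ≤ 2 * i / N) → F l = 0) :
    hemisphere v N i F = 0 := by
  have hN' : (0 : ℝ) < N := by positivity
  induction i generalizing F with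
  | zero =>
    refine hF _ rfl ?_ ?_
    · simpa using h0
    · simp
  | succ i ih =>
    rw [hemisphere]
    refine Finset.sum_eq_zero fun j hj => ?_
    have hjN : (j : ℝ) + 1 ≤ N := by exact_mod_cast Finset.mem_range.1 hj
    have key : ∀ l : List E, l.length = i + 1 → (∀ x ∈ l, x ∈ S i) →
        (∀ x ∈ l, ∀ y ∈ l, ‖x - y‖ ≤ 2 * i / N) →
        prism (coneMap (v (i + 1)) (j / N)) (coneMap (v (i + 1)) ((j + 1 : ℕ) / N)) F l = 0 := by
      intro l hl hlS hld
      refine prism_eq_zero _ _ _ _ fun m hm hml => ?_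
      have hml' : ∀ y ∈ m, ∃ x ∈ l, ∃ t : ℝ, (j : ℝ) / N ≤ t ∧ t ≤ (j + 1 : ℕ) / N ∧
          y = coneMap (v (i + 1)) t x := by
        intro y hy
        have : (j : ℝ) / N ≤ (j + 1 : ℕ) / N := by
          rw [div_le_div_iff_of_pos_right hN']; push_cast; linarith
        obtain ⟨x, hx, rfl | rfl⟩ := hml y hy
        exacts [⟨x, hx, _, le_rfl, this, rfl⟩, ⟨x, hx, _, this, le_rfl, rfl⟩]
      have hj0 : (0 : ℝ) ≤ j / N := by positivity
      have hj1 : ((j + 1 : ℕ) : ℝ) / N ≤ 1 := by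
        rw [div_le_one hN']; push_cast; exact hjN
      refine hF m (by rw [hm, hl]) ?_ ?_
      · intro y hy
        obtain ⟨x, hx, t, h₁, h₂, rfl⟩ := hml' y hy
        exact hcone i hi t (by linarith) (by linarith) x (hlS x hx)
      · intro y hy y' hy'
        obtain ⟨x, hx, t, h₁, h₂, rfl⟩ := hml' y hy
        obtain ⟨x', hx', t', h₁', h₂', rfl⟩ := hml' y' hy'
        refine (norm_coneMap_sub_coneMap_le (by linarith) (by linarith) (hv _)
          (hS i x' (hlS x' hx'))).trans ?_
        have h : |t - t'| ≤ 1 / N := by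
          have : ((j + 1 : ℕ) : ℝ) / N = j / N + 1 / N := by push_cast; ring
          rw [abs_le]; constructor <;> linarith
        calc _ ≤ 2 * (i : ℝ) / N + 2 * (1 / N) := by
              have := hld x hx x' hx'; linarith
          _ = _ := by push_cast; ring
    rw [doubled, ih (by omega) _ key, ih (by omega), add_zero]
    intro l hl hlS hld
    refine key _ (by simpa using hl) ?_ ?_
    · intro y hy
      obtain ⟨x, hx, rfl⟩ := List.mem_map.1 hy
      exact hneg i x (hlS x hx)
    · intro y hy y' hy'
      obtain ⟨x, hx, rfl⟩ := List.mem_map.1 hy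
      obtain ⟨x', hx', rfl⟩ := List.mem_map.1 hy'
      rw [← neg_sub', norm_neg]
      exact hld x hx x' hx'

theorem cupCoboundary_map_neg {X : Type*} [Neg X] {s : ℕ → X → ZMod 2} {l : List X}
    (hs : ∀ j, ∀ x ∈ l, s j (-x) = s j x + 1) :
    cupCoboundary s (l.map Neg.neg) = cupCoboundary s l := by
  induction l with
  | nil => rfl
  | cons a l ih =>
    cases l with
    | nil => rfl
    | cons b l =>
      have h := ih fun j x hx => hs j x (List.mem_cons_of_mem _ hx)
      rw [List.map_cons] at h
      simp only [List.map_cons, cupCoboundary, h, List.length_map]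
      rw [hs _ a (by simp), hs _ b (by simp), add_add_add_comm, CharTwo.add_self_eq_zero (1 : ZMod 2),
        add_zero]

/-- The antipode preserves all differences of the `s j`, so only the leading factor of the primitive
changes, by 1. -/
theorem cupPrimitive_add_map_neg {X : Type*} [Neg X] {s : ℕ → X → ZMod 2} {l : List X}
    (hs : ∀ j, ∀ x ∈ l, s j (-x) = s j x + 1) :
    cupPrimitive s l + cupPrimitive s (l.map Neg.neg) + cupCoboundary s l = 0 := by
  cases l with
  | nil => simp [cupPrimitive, cupCoboundary, CharTwo.add_self_eq_zero]
  | cons a l =>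
    have h := cupCoboundary_map_neg hs
    rw [List.map_cons] at h
    simp only [List.map_cons, cupPrimitive, h, List.length_map]
    rw [hs _ a (by simp)]
    generalize s _ a = p
    generalize cupCoboundary s _ = q
    revert p q
    decide

/-- Functions `s_0, …, s_{n-1}` with `s_j (-x) = s_j x + 1` all change somewhere on some small
`n`-simplex of the `n`-dimensional sphere. -/
theorem exists_small_list {v : ℕ → E} {N n : ℕ} (hN : N ≠ 0) {S : ℕ → Set E}
    (h0 : v 0 ∈ S 0) (hneg : ∀ i, ∀ x ∈ S i, -x ∈ S i) (hv : ∀ i, ‖v i‖ ≤ 1)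
    (hS : ∀ i, ∀ x ∈ S i, ‖x‖ ≤ 1)
    (hcone : ∀ i < n, ∀ t : ℝ, 0 ≤ t → t ≤ 1 → ∀ x ∈ S i, coneMap (v (i + 1)) t x ∈ S (i + 1))
    {s : ℕ → E → ZMod 2} (hs : ∀ j, ∀ i ≤ n, ∀ x ∈ S i, s j (-x) = s j x + 1) :
    ∃ l : List E, l ≠ [] ∧ (∀ x ∈ l, x ∈ S n) ∧ (∀ x ∈ l, ∀ y ∈ l, ‖x - y‖ ≤ 2 * n / N) ∧
      ∀ j < n, ∃ a ∈ l, ∃ b ∈ l, s j a ≠ s j b := by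
  have h₁ : ∀ i ≤ n, hemisphere v N i (cupCoboundary s) = 1 := by
    intro i
    induction i with
    | zero => exact fun _ => rfl
    | succ i ih =>
      intro hi
      have e : cupCoboundary s = coboundary (cupPrimitive s) :=
        funext fun l => ((coboundary_cup s l).2).symm
      -- By Stokes the value is that of the primitive plus its antipode on the lower hemisphere;
      -- pointwise this sum is the lower cup product.
      rw [e, hemisphere_succ_coboundary v hN, ← ih (by omega), doubled, ← hemisphere_add,
        ← sub_eq_zero, CharTwo.sub_eq_add, ← hemisphere_add]
      refine hemisphere_eq_zero hN h0 hneg hv hS hcone i (by omega) _ fun l _ hlS _ => ?_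
      exact cupPrimitive_add_map_neg fun j x hx => hs j i (by omega) x (hlS x hx)
  by_contra hcon
  push Not at hcon
  have h₂ := hemisphere_eq_zero hN h0 hneg hv hS hcone n le_rfl (cupCoboundary s) (by
    intro l hl hlS hld
    by_contra hne
    obtain ⟨j, hj, hj'⟩ := hcon l (by rintro rfl; simp at hl) hlS hld
    obtain ⟨a, ha, b, hb, hab⟩ := exists_ne_of_cupCoboundary_ne_zero s l hne j (by omega)
    exact hab (hj' a ha b hb))
  rw [h₁ n le_rfl] at h₂
  exact one_ne_zero h₂

end Small

/-! ### Sign bits, Borsuk–Ulam and the genus of spheres -/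

section Sphere

/-- The unit sphere of the `ℓ¹`-norm. -/
def crossPolytope (k : ℕ) : Set (Fin k → ℝ) := {x | ∑ i, |x i| = 1}

theorem norm_le_one_of_mem_crossPolytope {k : ℕ} {x : Fin k → ℝ} (hx : x ∈ crossPolytope k) :
    ‖x‖ ≤ 1 := by
  rw [pi_norm_le_iff_of_nonneg zero_le_one]
  intro i
  rw [← show ∑ i, |x i| = 1 from hx]
  exact Finset.single_le_sum (f := fun i => |x i|) (fun i _ => abs_nonneg _) (Finset.mem_univ i)

theorem isCompact_crossPolytope (k : ℕ) : IsCompact (crossPolytope k) := by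
  refine Metric.isCompact_of_isClosed_isBounded
    (isClosed_eq (by fun_prop) continuous_const) ?_
  refine (Metric.isBounded_closedBall (x := (0 : Fin k → ℝ)) (r := 1)).subset fun x hx => ?_
  simpa using norm_le_one_of_mem_crossPolytope hx

theorem neg_mem_crossPolytope {k : ℕ} {x : Fin k → ℝ} (hx : x ∈ crossPolytope k) :
    -x ∈ crossPolytope k := by
  simpa [crossPolytope] using hx

theorem ne_zero_of_mem_crossPolytope {k : ℕ} {x : Fin k → ℝ} (hx : x ∈ crossPolytope k) :
    x ≠ 0 := by
  rintro rfl
  simp [crossPolytope] at hx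

/-- The sign of `r` as an element of `ZMod 2`, with ties resolved by the first nonzero
coordinate of `x`. -/
noncomputable def signBit {k : ℕ} (r : ℝ) (x : Fin k → ℝ) : ZMod 2 :=
  open Classical in if 0 < r ∨ r = 0 ∧ 0 < toLex x then 1 else 0

theorem signBit_of_pos {k : ℕ} {r : ℝ} (hr : 0 < r) (x : Fin k → ℝ) : signBit r x = 1 := by
  simp [signBit, hr]

theorem signBit_of_neg {k : ℕ} {r : ℝ} (hr : r < 0) (x : Fin k → ℝ) : signBit r x = 0 := by
  simp [signBit, hr.ne, hr.le]

/-- The tie-break keeps the bit antipodal even where `r = 0`; the cochain argument needs this at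
every point. -/
theorem signBit_neg {k : ℕ} (r : ℝ) {x : Fin k → ℝ} (hx : x ≠ 0) :
    signBit (-r) (-x) = signBit r x + 1 := by
  rcases lt_trichotomy r 0 with h | rfl | h
  · rw [signBit_of_neg h, signBit_of_pos (neg_pos.2 h), zero_add]
  · have hx' : toLex x ≠ 0 := fun h => hx (toLex.injective h)
    have e : toLex (-x) = -toLex x := rfl
    rw [signBit, signBit, e]
    generalize toLex x = y at hx'
    rcases lt_or_gt_of_ne hx' with h' | h'
    · rw [if_pos (Or.inr ⟨neg_zero, neg_pos.2 h'⟩), if_neg, zero_add]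
      exact fun h => h.elim (lt_irrefl _) fun h => h'.not_gt h.2
    · rw [if_neg, if_pos (Or.inr ⟨rfl, h'⟩), CharTwo.add_self_eq_zero]
      exact fun h => h.elim (fun h => by simp at h) fun h => h'.not_gt (neg_pos.1 h.2)
  · rw [signBit_of_pos h, signBit_of_neg (neg_lt_zero.2 h), CharTwo.add_self_eq_zero]

/-- Different bits exclude equal strict signs, so zero lies weakly between `r` and `r'`. -/
theorem abs_le_of_signBit_ne {k : ℕ} {r r' : ℝ} {x x' : Fin k → ℝ}
    (h : signBit r x ≠ signBit r' x') : |r| ≤ |r - r'| := by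
  rcases lt_trichotomy r 0 with h₁ | rfl | h₁
  · have h₂ : 0 ≤ r' := not_lt.1 fun h₂ => h (by rw [signBit_of_neg h₁, signBit_of_neg h₂])
    rw [abs_of_nonpos h₁.le, abs_of_nonpos (by linarith)]
    linarith
  · simp
  · have h₂ : r' ≤ 0 := not_lt.1 fun h₂ => h (by rw [signBit_of_pos h₁, signBit_of_pos h₂])
    rw [abs_of_nonneg h₁.le, abs_of_nonneg (by linarith)]
    linarith

/-- The **Borsuk–Ulam theorem**. -/
theorem borsuk_ulam {k m : ℕ} (hmk : m < k) {f : (Fin k → ℝ) → Fin m → ℝ}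
    (hf : ContinuousOn f (crossPolytope k)) (hodd : ∀ x ∈ crossPolytope k, f (-x) = -f x) :
    ∃ x ∈ crossPolytope k, f x = 0 := by
  by_contra! hne
  set K := crossPolytope k
  let v : ℕ → Fin k → ℝ := fun i => if h : i < k then Pi.single ⟨i, h⟩ 1 else 0
  let S : ℕ → Set (Fin k → ℝ) := fun i => {x | x ∈ K ∧ ∀ j : Fin k, i < j → x j = 0}
  have hv0 : v 0 ∈ K := by
    have h : 0 < k := by omega
    simp only [v, h, dif_pos]
    change ∑ i, |(Pi.single (⟨0, h⟩ : Fin k) (1 : ℝ) : Fin k → ℝ) i| = 1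
    simp [Pi.single_apply, apply_ite abs]
  obtain ⟨c, hc, hfc⟩ : ∃ c > 0, ∀ x ∈ K, c ≤ ‖f x‖ := by
    obtain ⟨x, hx, hmin⟩ := (isCompact_crossPolytope k).exists_isMinOn ⟨_, hv0⟩ hf.norm
    exact ⟨‖f x‖, norm_pos_iff.2 (hne x hx), fun y hy => hmin hy⟩
  obtain ⟨δ, hδ, hfδ⟩ := Metric.uniformContinuousOn_iff.1
    ((isCompact_crossPolytope k).uniformContinuousOn_of_continuous hf) (c / 2) (by positivity)
  -- The simplices will have diameter at most 2m/N, hence below δ.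
  obtain ⟨N, hN⟩ := exists_nat_gt (2 * m / δ)
  have hN0 : (0 : ℝ) < N := lt_of_le_of_lt (by positivity) hN
  -- The filler 0 for `j ≥ m` is still odd.
  let r : ℕ → (Fin k → ℝ) → ℝ := fun j x => if h : j < m then f x ⟨j, h⟩ else 0
  have h0 : v 0 ∈ S 0 := by
    refine ⟨hv0, fun j hj => ?_⟩
    have h : 0 < k := by omega
    simp only [v, h, dif_pos]
    rw [Pi.single_apply, if_neg]
    exact fun e => by simp [e] at hj
  have hv1 : ∀ i, ‖v i‖ ≤ 1 := by
    intro i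
    rw [pi_norm_le_iff_of_nonneg zero_le_one]
    intro j
    simp only [v]
    split_ifs with h
    · rw [Pi.single_apply]; split_ifs <;> simp
    · simp
  have hcone : ∀ i < m, ∀ t : ℝ, 0 ≤ t → t ≤ 1 → ∀ x ∈ S i,
      coneMap (v (i + 1)) t x ∈ S (i + 1) := by
    intro i hi t ht ht' x hx
    have h : i + 1 < k := by omega
    have hv : ∀ j : Fin k, v (i + 1) j = if j = ⟨i + 1, h⟩ then 1 else 0 := by
      intro j
      simp only [v, h, dif_pos, Pi.single_apply]
    refine ⟨?_, fun j hj => ?_⟩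
    -- `x` vanishes at coordinate `i + 1`, so the supports are disjoint and the segment stays on the
    -- ℓ¹-sphere without renormalisation.
    · have e : ∀ j, |coneMap (v (i + 1)) t x j| = (1 - t) * |x j| + t * v (i + 1) j := by
        intro j
        simp only [coneMap, Pi.add_apply, Pi.smul_apply, smul_eq_mul, hv]
        split_ifs with hj
        · rw [hx.2 j (by rw [hj]; simp)]; simp [abs_of_nonneg ht]
        · simp [abs_mul, abs_of_nonneg (sub_nonneg.2 ht')]
      change ∑ j, |coneMap (v (i + 1)) t x j| = 1
      have hx1 : ∑ j, |x j| = 1 := hx.1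
      simp only [e, Finset.sum_add_distrib, ← Finset.mul_sum, hx1, hv]
      simp
    · simp only [coneMap, Pi.add_apply, Pi.smul_apply, smul_eq_mul, hv]
      rw [hx.2 j (by omega), if_neg (fun e => by simp [e] at hj)]
      simp
  have hs : ∀ j, ∀ i ≤ m, ∀ x ∈ S i,
      signBit (r j (-x)) (-x) = signBit (r j x) x + 1 := by
    intro j i _ x hx
    have : r j (-x) = -r j x := by
      simp only [r, hodd x hx.1]
      split_ifs <;> simp
    rw [this, signBit_neg _ (ne_zero_of_mem_crossPolytope hx.1)]
  obtain ⟨l, hl, hlS, hld, hls⟩ := exists_small_list (N := N) (n := m)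
    (by rintro rfl; simp at hN0) h0
    (fun i x hx => ⟨neg_mem_crossPolytope hx.1, fun j hj => by simp [hx.2 j hj]⟩)
    hv1 (fun i x hx => norm_le_one_of_mem_crossPolytope hx.1) hcone
    (s := fun j x => signBit (r j x) x) hs
  obtain ⟨a, ha⟩ := List.exists_mem_of_ne_nil l hl
  have hclose : ∀ x ∈ l, ∀ y ∈ l, ∀ j, |f x j - f y j| < c / 2 := by
    intro x hx y hy j
    have h : dist x y < δ := by
      rw [dist_eq_norm]
      refine (hld x hx y hy).trans_lt ?_
      rw [div_lt_iff₀ hN0]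
      rw [div_lt_iff₀ hδ] at hN
      linarith
    have := hfδ x (hlS x hx).1 y (hlS y hy).1 h
    exact (dist_le_pi_dist (f x) (f y) j).trans_lt this
  refine (hfc a (hlS a ha).1).not_gt ((pi_norm_lt_iff hc).2 fun j => ?_)
  obtain ⟨x, hx, y, hy, hxy⟩ := hls j j.2
  have h₁ := abs_le_of_signBit_ne hxy
  simp only [r, j.2, dif_pos] at h₁
  have h₂ := hclose x hx y hy j
  have h₃ := hclose a ha x hx j
  have h₄ : |f a j| ≤ |f a j - f x j| + |f x j| := by
    simpa using abs_add_le (f a j - f x j) (f x j)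
  rw [Real.norm_eq_abs]
  change |f x j| ≤ |f x j - f y j| at h₁
  linarith

theorem le_genus_image {E : Type*} [TopologicalSpace E] [Neg E] {k : ℕ}
    {g : (Fin k → ℝ) → E} (hg : ContinuousOn g (crossPolytope k))
    (hodd : ∀ x ∈ crossPolytope k, g (-x) = -g x) :
    (k : ℕ∞) ≤ genus (g '' crossPolytope k) := by
  refine le_iInf₂ fun m ⟨f, hf, hfo, hf0⟩ => ?_
  by_contra! hlt
  obtain ⟨x, hx, h⟩ := borsuk_ulam (f := f ∘ g) (by exact_mod_cast hlt)
    (hf.comp hg (Set.mapsTo_image _ _)) (fun x hx => by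
      rw [Function.comp, hodd x hx, hfo _ (Set.mem_image_of_mem _ hx)]; rfl)
  exact hf0 _ (Set.mem_image_of_mem _ hx) h

end Sphere

open scoped Matrix

/-! ### Edge sums, I⁺ and the quadratic form Q -/

section Graph

variable {V : Type*} [Fintype V] (G : SimpleGraph V) [DecidableRel G.Adj]

theorem sum_degree_mul (g : V → ℝ) :
    ∑ i, (G.degree i : ℝ) * g i = ∑ i, ∑ j, if G.Adj i j then g i else 0 := by
  refine Finset.sum_congr rfl fun i _ => ?_
  rw [SimpleGraph.degree_eq_sum_if_adj, Finset.sum_mul]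
  simp

theorem sum_degree_mul' (g : V → ℝ) :
    ∑ i, (G.degree i : ℝ) * g i = ∑ i, ∑ j, if G.Adj i j then g j else 0 := by
  rw [sum_degree_mul, Finset.sum_comm]
  simp only [G.adj_comm]

/-- The vector `D^{1/2} x`. -/
noncomputable def degreeScale (x : V → ℝ) : EuclideanSpace ℝ V :=
  WithLp.toLp 2 fun i => √(G.degree i) * x i

theorem inner_degreeScale_self (x : V → ℝ) :
    inner ℝ (degreeScale G x) (degreeScale G x) = ∑ i, (G.degree i : ℝ) * x i ^ 2 := by
  rw [PiLp.inner_apply]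
  refine Finset.sum_congr rfl fun i _ => ?_
  have := Real.sq_sqrt (Nat.cast_nonneg (α := ℝ) (G.degree i))
  simp only [degreeScale, RCLike.inner_apply, conj_trivial]
  linear_combination (x i ^ 2) * this

variable [DecidableEq V]

theorem sum_edgeFinset_lift (f : V → V → ℝ) (hf : ∀ i j, f i j = f j i) :
    ∑ e ∈ G.edgeFinset, Sym2.lift ⟨f, hf⟩ e =
      (∑ i, ∑ j, if G.Adj i j then f i j else 0) / 2 := by
  set P : Finset (V × V) := Finset.univ.filter fun p => G.Adj p.1 p.2 with hP
  have h₁ : ∑ i, ∑ j, (if G.Adj i j then f i j else 0) = ∑ p ∈ P, f p.1 p.2 := by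
    rw [hP, Finset.sum_filter, Fintype.sum_prod_type]
  have h₂ : ∀ p ∈ P, s(p.1, p.2) ∈ G.edgeFinset := by
    intro p hp
    simpa [hP] using hp
  rw [h₁, ← Finset.sum_fiberwise_of_maps_to h₂, Finset.sum_div]
  refine Finset.sum_congr rfl fun e he => ?_
  induction e with
  | _ a b =>
    have hab : G.Adj a b := by simpa using he
    have hfib : P.filter (fun p => s(p.1, p.2) = s(a, b)) = {(a, b), (b, a)} := by
      ext ⟨x, y⟩
      simp only [hP, Finset.mem_filter, Finset.mem_univ, true_and, Sym2.eq_iff,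
        Finset.mem_insert, Finset.mem_singleton, Prod.mk.injEq]
      constructor
      · exact fun h => h.2
      · rintro (⟨rfl, rfl⟩ | ⟨rfl, rfl⟩)
        exacts [⟨hab, by simp⟩, ⟨hab.symm, by simp⟩]
    rw [hfib, Finset.sum_pair (by simp [hab.ne])]
    simp only [Sym2.lift_mk, hf b a]
    ring

theorem signlessTV_eq (x : V → ℝ) :
    signlessTV G x = (∑ i, ∑ j, if G.Adj i j then |x i + x j| else 0) / 2 :=
  sum_edgeFinset_lift G (fun i j => |x i + x j|) _

/-- The quadratic form `∑_{{i,j} ∈ E} (x_i + x_j)²`. -/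
noncomputable def signlessForm (x : V → ℝ) : ℝ :=
  (∑ i, ∑ j, if G.Adj i j then (x i + x j) ^ 2 else 0) / 2

/-- Edgewise, (a + b)² + (a - b)² = 2a² + 2b². -/
theorem signlessForm_add_lapMatrix (x : V → ℝ) :
    signlessForm G x + x ⬝ᵥ (G.lapMatrix ℝ *ᵥ x) = 2 * ∑ i, (G.degree i : ℝ) * x i ^ 2 := by
  have h := G.lapMatrix_toLinearMap₂' ℝ x
  rw [Matrix.toLinearMap₂'_apply'] at h
  rw [h, signlessForm, two_mul]
  nth_rw 1 [sum_degree_mul]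
  rw [sum_degree_mul', ← add_div, ← Finset.sum_add_distrib, ← Finset.sum_add_distrib,
    Finset.sum_div]
  refine Finset.sum_congr rfl fun i _ => ?_
  rw [← Finset.sum_add_distrib, ← Finset.sum_add_distrib, Finset.sum_div]
  refine Finset.sum_congr rfl fun j _ => ?_
  split_ifs <;> ring

theorem signlessTV_nonneg (x : V → ℝ) : 0 ≤ signlessTV G x := by
  rw [signlessTV_eq]
  positivity

theorem signlessTV_le_degreeNorm (x : V → ℝ) : signlessTV G x ≤ degreeNorm G x := by
  have h₁ := sum_degree_mul G fun i => |x i|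
  have h₂ := sum_degree_mul' G fun i => |x i|
  have h : degreeNorm G x = (∑ i, ∑ j, if G.Adj i j then |x i| + |x j| else 0) / 2 := by
    rw [degreeNorm, ← add_self_div_two (∑ i, (G.degree i : ℝ) * |x i|)]
    nth_rw 1 [h₁]
    rw [h₂, ← Finset.sum_add_distrib]
    simp only [← Finset.sum_add_distrib, ite_add_ite, add_zero]
  rw [h, signlessTV_eq]
  gcongr with i _ j _
  split_ifs
  exacts [abs_add_le _ _, le_rfl]

/-- Equality holds for opposite signs; for equal signs it reads a² + b² ≤ (a + b)². -/
theorem abs_mul_abs_add_le (a b : ℝ) :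
    |a * |a| + b * (|b|)| ≤ |a + b| * (|a| + |b|) := by
  rcases le_total 0 a with ha | ha <;> rcases le_total 0 b with hb | hb
  · rw [abs_of_nonneg ha, abs_of_nonneg hb, abs_of_nonneg (by positivity),
      abs_of_nonneg (by positivity)]
    nlinarith [mul_nonneg ha hb]
  · rw [abs_of_nonneg ha, abs_of_nonpos hb, show a * a + b * -b = (a + b) * (a + -b) by ring,
      abs_mul, abs_of_nonneg (show 0 ≤ a + -b by linarith)]
  · rw [abs_of_nonpos ha, abs_of_nonneg hb, show a * -a + b * b = (a + b) * (-a + b) by ring,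
      abs_mul, abs_of_nonneg (show 0 ≤ -a + b by linarith)]
  · rw [abs_of_nonpos ha, abs_of_nonpos hb, show a * -a + b * -b = -(a * a + b * b) by ring,
      abs_neg, abs_of_nonneg (add_nonneg (mul_self_nonneg a) (mul_self_nonneg b)), abs_of_nonpos (by linarith)]
    nlinarith [mul_nonneg_of_nonpos_of_nonpos ha hb]

/-- Cauchy–Schwarz for |y_i + y_j| against |y_i| + |y_j| over ordered adjacent pairs. -/
theorem signlessTV_sq_le (y : V → ℝ) :
    signlessTV G (fun i => y i * |y i|) ^ 2 ≤
      signlessForm G y * (2 * ∑ i, (G.degree i : ℝ) * y i ^ 2) := by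
  set P : Finset (V × V) := Finset.univ.filter fun p => G.Adj p.1 p.2 with hP
  have h : ∀ f : V → V → ℝ,
      ∑ i, ∑ j, (if G.Adj i j then f i j else 0) = ∑ p ∈ P, f p.1 p.2 := fun f => by
    rw [hP, Finset.sum_filter, Fintype.sum_prod_type]
  have h₁ : ∑ p ∈ P, |y p.1 * |y p.1| + y p.2 * (|y p.2|)| ≤
      ∑ p ∈ P, |y p.1 + y p.2| * (|y p.1| + |y p.2|) :=
    Finset.sum_le_sum fun p _ => abs_mul_abs_add_le _ _
  have h₂ := Finset.sum_mul_sq_le_sq_mul_sq P (fun p => |y p.1 + y p.2|)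
    (fun p => |y p.1| + |y p.2|)
  have h₃ : ∑ p ∈ P, (|y p.1| + |y p.2|) ^ 2 ≤ 4 * ∑ i, (G.degree i : ℝ) * y i ^ 2 := by
    calc _ ≤ ∑ p ∈ P, (2 * y p.1 ^ 2 + 2 * y p.2 ^ 2) := by
          refine Finset.sum_le_sum fun p _ => ?_
          nlinarith [sq_nonneg (|y p.1| - |y p.2|), sq_abs (y p.1), sq_abs (y p.2)]
      _ = _ := by
          rw [Finset.sum_add_distrib, ← Finset.mul_sum, ← Finset.mul_sum,
            ← h fun i _ => y i ^ 2, ← h fun _ j => y j ^ 2,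
            ← sum_degree_mul G fun i => y i ^ 2, ← sum_degree_mul' G fun i => y i ^ 2]
          ring
  have h₄ : 0 ≤ ∑ p ∈ P, |y p.1 * |y p.1| + y p.2 * (|y p.2|)| := by positivity
  simp only [sq_abs] at h₂
  have h₅ : 0 ≤ ∑ p ∈ P, (y p.1 + y p.2) ^ 2 := by positivity
  rw [signlessTV_eq, signlessForm, h fun i j => |y i * |y i| + y j * (|y j|)|,
    h fun i j => (y i + y j) ^ 2]
  have h₆ := pow_le_pow_left₀ h₄ h₁ 2
  have h₇ := mul_le_mul_of_nonneg_left h₃ h₅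
  rw [div_pow]
  linarith

/-- The odd square root, `√a` for `a ≥ 0` and `-√(-a)` for `a ≤ 0`. -/
noncomputable def oddSqrt (a : ℝ) : ℝ := √a - √(-a)

theorem oddSqrt_neg (a : ℝ) : oddSqrt (-a) = -oddSqrt a := by simp [oddSqrt]

theorem continuous_oddSqrt : Continuous oddSqrt := by unfold oddSqrt; fun_prop

theorem oddSqrt_of_nonneg {a : ℝ} (ha : 0 ≤ a) : oddSqrt a = √a := by
  rw [oddSqrt, Real.sqrt_eq_zero_of_nonpos (neg_nonpos.2 ha), sub_zero]

theorem oddSqrt_sq (a : ℝ) : oddSqrt a ^ 2 = |a| := by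
  rcases le_total 0 a with ha | ha
  · rw [oddSqrt_of_nonneg ha, Real.sq_sqrt ha, abs_of_nonneg ha]
  · rw [← neg_neg a, oddSqrt_neg, neg_sq, oddSqrt_of_nonneg (neg_nonneg.2 ha),
      Real.sq_sqrt (neg_nonneg.2 ha), abs_neg, abs_of_nonneg (neg_nonneg.2 ha)]

/-- The factor 2 is needed only for equal signs. For opposite signs, |√a - √b| ≤ √a + √b even gives
(√a - √b)² ≤ |a - b|. -/
theorem oddSqrt_add_sq_le (a b : ℝ) : (oddSqrt a + oddSqrt b) ^ 2 ≤ 2 * |a + b| := by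
  have same : ∀ a b : ℝ, 0 ≤ a → 0 ≤ b → (oddSqrt a + oddSqrt b) ^ 2 ≤ 2 * |a + b| := by
    intro a b ha hb
    rw [abs_of_nonneg (add_nonneg ha hb)]
    have h₁ := oddSqrt_sq a
    have h₂ := oddSqrt_sq b
    rw [abs_of_nonneg ha] at h₁
    rw [abs_of_nonneg hb] at h₂
    nlinarith [sq_nonneg (oddSqrt a - oddSqrt b)]
  have opp : ∀ a b : ℝ, 0 ≤ a → 0 ≤ b → (oddSqrt a - oddSqrt b) ^ 2 ≤ 2 * |a - b| := by
    intro a b ha hb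
    rw [oddSqrt_of_nonneg ha, oddSqrt_of_nonneg hb]
    have h : a - b = (√a - √b) * (√a + √b) := by
      linear_combination -Real.sq_sqrt ha + Real.sq_sqrt hb
    rw [h, abs_mul, abs_of_nonneg (show 0 ≤ √a + √b by positivity), ← sq_abs]
    have h' : |√a - √b| ≤ √a + √b :=
      abs_le.2 ⟨by linarith [Real.sqrt_nonneg a], by linarith [Real.sqrt_nonneg b]⟩
    nlinarith [abs_nonneg (√a - √b)]
  rcases le_total 0 a with ha | ha <;> rcases le_total 0 b with hb | hb
  · exact same a b ha hb
  · have := opp a (-b) ha (neg_nonneg.2 hb)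
    rwa [oddSqrt_neg, sub_neg_eq_add, sub_neg_eq_add] at this
  · have := opp b (-a) hb (neg_nonneg.2 ha)
    rwa [oddSqrt_neg, sub_neg_eq_add, sub_neg_eq_add, add_comm, add_comm b] at this
  · have := same (-a) (-b) (neg_nonneg.2 ha) (neg_nonneg.2 hb)
    rwa [oddSqrt_neg, oddSqrt_neg, ← neg_add, ← neg_add, neg_sq, abs_neg] at this

theorem signlessForm_oddSqrt_le (x : V → ℝ) :
    signlessForm G (fun i => oddSqrt (x i)) ≤ 2 * signlessTV G x := by
  rw [signlessForm, signlessTV_eq, mul_div_assoc', Finset.mul_sum]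
  gcongr with i _
  rw [Finset.mul_sum]
  gcongr with j _
  split_ifs
  exacts [oddSqrt_add_sq_le _ _, by simp]

/-! ### Diagonalisation of Q -/

/-- The `a`-th smallest eigenvalue of `2 - Δ₂`, counted from `0`. -/
noncomputable def signlessEigenvalue (a : Fin (Fintype.card V)) : ℝ :=
  2 - (normalizedLaplacian_isHermitian G).eigenvalues₀ a

theorem signlessEigenvalue_mono : Monotone (signlessEigenvalue G) := fun _ _ h =>
  sub_le_sub_left ((normalizedLaplacian_isHermitian G).eigenvalues₀_antitone h) _

theorem two_sub_laplacianEigenvalue {k : ℕ} (hk : 1 ≤ k) (hkn : k ≤ Fintype.card V) :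
    2 - laplacianEigenvalue G (Fintype.card V - k + 1) =
      signlessEigenvalue G ⟨k - 1, by omega⟩ := by
  rw [laplacianEigenvalue, dif_pos ⟨by omega, by omega⟩, signlessEigenvalue]
  congr 3
  omega

/-- The orthonormal basis of eigenvectors of `Δ₂`, in the order of `signlessEigenvalue`. -/
noncomputable def eigenbasis :
    OrthonormalBasis (Fin (Fintype.card V)) ℝ (EuclideanSpace ℝ V) :=
  (normalizedLaplacian_isHermitian G).eigenvectorBasis.reindex
    (Fintype.equivOfCardEq (Fintype.card_fin _)).symm

theorem mulVec_eigenbasis (a : Fin (Fintype.card V)) :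
    normalizedLaplacian G *ᵥ ⇑(eigenbasis G a) =
      (2 - signlessEigenvalue G a) • ⇑(eigenbasis G a) := by
  have := (normalizedLaplacian_isHermitian G).mulVec_eigenvectorBasis
    (Fintype.equivOfCardEq (Fintype.card_fin _) a)
  simpa [eigenbasis, signlessEigenvalue, Matrix.IsHermitian.eigenvalues] using this

theorem sum_inner_eigenbasis_sq (x : V → ℝ) :
    ∑ a, inner ℝ (eigenbasis G a) (degreeScale G x) ^ 2 =
      ∑ i, (G.degree i : ℝ) * x i ^ 2 := by
  rw [← inner_degreeScale_self, ← (eigenbasis G).sum_inner_mul_inner]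
  refine Finset.sum_congr rfl fun a _ => ?_
  rw [real_inner_comm (eigenbasis G a), sq]

theorem dotProduct_normalizedLaplacian (hdeg : ∀ v, 0 < G.degree v) (x : V → ℝ) :
    ⇑(degreeScale G x) ⬝ᵥ (normalizedLaplacian G *ᵥ ⇑(degreeScale G x)) =
      x ⬝ᵥ (G.lapMatrix ℝ *ᵥ x) := by
  -- Without isolated vertices, D^{-1/2} inverts D^{1/2}.
  have h : Matrix.diagonal (fun v => (√(G.degree v))⁻¹) *ᵥ ⇑(degreeScale G x) = x := by
    ext i
    have : √(G.degree i : ℝ) ≠ 0 := by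
      have := hdeg i
      positivity
    simp [Matrix.mulVec_diagonal, degreeScale, this]
  rw [normalizedLaplacian, ← Matrix.mulVec_mulVec, h, ← Matrix.mulVec_mulVec,
    Matrix.dotProduct_mulVec, ← Matrix.mulVec_transpose, Matrix.diagonal_transpose, h]

theorem signlessForm_eq_sum (hdeg : ∀ v, 0 < G.degree v) (x : V → ℝ) :
    signlessForm G x =
      ∑ a, signlessEigenvalue G a * inner ℝ (eigenbasis G a) (degreeScale G x) ^ 2 := by
  have h₁ := signlessForm_add_lapMatrix G x
  rw [← dotProduct_normalizedLaplacian G hdeg, ← sum_inner_eigenbasis_sq] at h₁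
  have h₂ : ⇑(degreeScale G x) ⬝ᵥ (normalizedLaplacian G *ᵥ ⇑(degreeScale G x)) =
      ∑ a, (2 - signlessEigenvalue G a) *
        inner ℝ (eigenbasis G a) (degreeScale G x) ^ 2 := by
    set z := degreeScale G x
    have hz : ⇑z = ∑ a, inner ℝ (eigenbasis G a) z • ⇑(eigenbasis G a) := by
      conv_lhs => rw [← (eigenbasis G).sum_repr' z]
      simp
    conv_lhs => rw [hz, Matrix.mulVec_sum, ← hz, dotProduct_sum]
    refine Finset.sum_congr rfl fun a _ => ?_
    rw [Matrix.mulVec_smul, mulVec_eigenbasis, dotProduct_smul, dotProduct_smul]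
    have : ⇑z ⬝ᵥ ⇑(eigenbasis G a) = inner ℝ (eigenbasis G a) z := by
      simp [PiLp.inner_apply, dotProduct]
    rw [this]
    simp only [smul_eq_mul]
    ring
  rw [h₂, Finset.mul_sum] at h₁
  rw [eq_sub_of_add_eq h₁, ← Finset.sum_sub_distrib]
  refine Finset.sum_congr rfl fun a _ => ?_
  ring

/-! ### Test points, test sets and the two bounds -/

/-- A compact symmetric set of genus at least `k` meets the orthogonal complement of the first
`k - 1` eigenvectors after the odd square root is applied to the coordinates. -/
theorem exists_signlessEigenvalue_le (hdeg : ∀ v, 0 < G.degree v) {k : ℕ} (hk : 1 ≤ k)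
    (hkn : k ≤ Fintype.card V) {A : Set (V → ℝ)} (hA : A ∈ admissible G k) :
    ∃ x ∈ A, signlessEigenvalue G ⟨k - 1, by omega⟩ ≤ 2 * signlessTV G x := by
  obtain ⟨hAX, -, -, hgen⟩ := hA
  let f : (V → ℝ) → Fin (k - 1) → ℝ := fun x a =>
    inner ℝ (eigenbasis G ⟨a, by omega⟩) (degreeScale G fun i => oddSqrt (x i))
  have hf : Continuous f := by
    refine continuous_pi fun a => Continuous.inner continuous_const ?_
    refine (PiLp.continuous_toLp 2 _).comp (continuous_pi fun i => ?_)
    exact continuous_const.mul (continuous_oddSqrt.comp (continuous_apply i))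
  have hodd : ∀ x, f (-x) = -f x := by
    intro x
    funext a
    have : (degreeScale G fun i => oddSqrt ((-x) i)) = -degreeScale G fun i => oddSqrt (x i) := by
      ext i
      simp [degreeScale, oddSqrt_neg]
    change inner ℝ _ (degreeScale G fun i => oddSqrt ((-x) i)) = _
    rw [this, inner_neg_right]
    rfl
  obtain ⟨x, hxA, hx⟩ : ∃ x ∈ A, f x = 0 := by
    by_contra! hne
    -- A nowhere vanishing `f` would witness genus at most k - 1.
    have : genus A ≤ (k - 1 : ℕ) := iInf₂_le (k - 1) ⟨f, hf.continuousOn, fun x _ => hodd x, hne⟩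
    have := hgen.trans this
    rw [Nat.cast_le] at this
    omega
  refine ⟨x, hxA, le_trans ?_ (signlessForm_oddSqrt_le G x)⟩
  have hnorm : ∑ i, (G.degree i : ℝ) * oddSqrt (x i) ^ 2 = 1 := by
    simp only [oddSqrt_sq]
    exact hAX hxA
  rw [← mul_one (signlessEigenvalue G _), ← hnorm, signlessForm_eq_sum G hdeg,
    ← sum_inner_eigenbasis_sq, Finset.mul_sum]
  refine Finset.sum_le_sum fun a _ => ?_
  by_cases ha : (a : ℕ) < k - 1
  · have : inner ℝ (eigenbasis G a) (degreeScale G fun i => oddSqrt (x i)) = 0 :=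
      congrFun hx ⟨a, ha⟩
    simp [this]
  · exact mul_le_mul_of_nonneg_right
      (signlessEigenvalue_mono G (Fin.mk_le_of_le_val (not_lt.1 ha))) (sq_nonneg _)

/-- The image of the sphere in the span of the first `k` eigenvectors under the map
`y_i ↦ y_i |y_i|` is a set of genus at least `k`. -/
theorem exists_admissible (hdeg : ∀ v, 0 < G.degree v) {k : ℕ} (hk : 1 ≤ k)
    (hkn : k ≤ Fintype.card V) :
    ∃ A ∈ admissible G k, ∀ x ∈ A,
      signlessTV G x ^ 2 ≤ 2 * signlessEigenvalue G ⟨k - 1, by omega⟩ := by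
  have hd : ∀ i, √(G.degree i : ℝ) ≠ 0 := fun i => by
    have := hdeg i
    positivity
  let u : Fin k → EuclideanSpace ℝ V := fun a => eigenbasis G (Fin.castLE hkn a)
  let y : (Fin k → ℝ) → V → ℝ := fun c i => (∑ a, c a * u a i) / √(G.degree i)
  have hy : ∀ c, degreeScale G (y c) = ∑ a, c a • u a := by
    intro c
    ext i
    simp [degreeScale, y, mul_div_cancel₀ _ (hd i)]
  have hu : Orthonormal ℝ u := (eigenbasis G).orthonormal.comp _ (Fin.castLE_injective hkn)
  have hcoef : ∀ c a, inner ℝ (u a) (degreeScale G (y c)) = c a := by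
    intro c a
    rw [hy]
    exact hu.inner_right_fintype c a
  have hsum : ∀ c, ∑ i, (G.degree i : ℝ) * y c i ^ 2 = ∑ a, c a ^ 2 := by
    intro c
    rw [← inner_degreeScale_self]
    nth_rw 1 [hy]
    rw [sum_inner]
    refine Finset.sum_congr rfl fun a _ => ?_
    rw [real_inner_smul_left, hcoef, sq]
  have hform : ∀ c, signlessForm G (y c) ≤
      signlessEigenvalue G ⟨k - 1, by omega⟩ * ∑ a, c a ^ 2 := by
    intro c
    rw [← hsum, signlessForm_eq_sum G hdeg, ← sum_inner_eigenbasis_sq, Finset.mul_sum]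
    refine Finset.sum_le_sum fun a _ => ?_
    by_cases ha : (a : ℕ) < k
    · exact mul_le_mul_of_nonneg_right
        (signlessEigenvalue_mono G (Fin.le_def.2 (by simp only; omega))) (sq_nonneg _)
    · have : inner ℝ (eigenbasis G a) (degreeScale G (y c)) = 0 := by
        rw [hy, inner_sum]
        refine Finset.sum_eq_zero fun b _ => ?_
        rw [real_inner_smul_right, (eigenbasis G).inner_eq_zero, mul_zero]
        rintro rfl
        exact ha b.2
      simp [this]
  -- The divisor is ∑ d_i y_i², the degree norm of y|y|, so `g` lands in X.
  let g : (Fin k → ℝ) → V → ℝ := fun c i => (y c i * |y c i|) / ∑ a, c a ^ 2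
  have hpos : ∀ c ∈ crossPolytope k, 0 < ∑ a, c a ^ 2 := by
    intro c hc
    obtain ⟨a, ha⟩ := Function.ne_iff.1 (ne_zero_of_mem_crossPolytope hc)
    exact Finset.sum_pos' (fun _ _ => sq_nonneg _) ⟨a, Finset.mem_univ a, by
      have : c a ≠ 0 := ha
      positivity⟩
  have hycont : Continuous y := by
    refine continuous_pi fun i => ?_
    fun_prop
  have hgcont : ContinuousOn g (crossPolytope k) := by
    refine continuousOn_pi.2 fun i => ContinuousOn.div ?_ ?_ fun c hc => (hpos c hc).ne'
    · have := (continuous_apply i).comp hycont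
      exact (this.mul this.abs).continuousOn
    · fun_prop
  have hgodd : ∀ c, g (-c) = -g c := by
    intro c
    have hyodd : ∀ i, y (-c) i = -y c i := by
      intro i
      simp [y, neg_div]
    funext i
    simp [g, hyodd, neg_div]
  refine ⟨g '' crossPolytope k, ⟨?_, (isCompact_crossPolytope k).image_of_continuousOn hgcont,
    ?_, le_genus_image hgcont fun c _ => hgodd c⟩, ?_⟩
  · rintro _ ⟨c, hc, rfl⟩
    have h := hpos c hc
    change ∑ i, (G.degree i : ℝ) * |g c i| = 1
    rw [← div_self h.ne', ← hsum, Finset.sum_div]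
    refine Finset.sum_congr rfl fun i _ => ?_
    simp only [g]
    rw [hsum, abs_div, abs_of_pos h, abs_mul, abs_abs, abs_mul_abs_self, mul_div_assoc', sq]
  · rintro _ ⟨c, hc, rfl⟩
    exact ⟨-c, neg_mem_crossPolytope hc, hgodd c⟩
  · rintro _ ⟨c, hc, rfl⟩
    have h := hpos c hc
    have hTV : signlessTV G (g c) = signlessTV G (fun i => y c i * |y c i|) / ∑ a, c a ^ 2 := by
      rw [signlessTV_eq, signlessTV_eq, div_right_comm]
      congr 1
      rw [Finset.sum_div]
      refine Finset.sum_congr rfl fun i _ => ?_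
      rw [Finset.sum_div]
      refine Finset.sum_congr rfl fun j _ => ?_
      simp only [g]
      rw [← add_div, abs_div, abs_of_pos h]
      split_ifs <;> simp
    have h₁ := signlessTV_sq_le G (y c)
    rw [hsum] at h₁
    rw [hTV, div_pow, div_le_iff₀ (by positivity)]
    nlinarith [mul_le_mul_of_nonneg_right (hform c) h.le]

theorem minMaxEigenvalue_nonneg (k : ℕ) : 0 ≤ minMaxEigenvalue G k := by
  refine Real.sInf_nonneg ?_
  rintro _ ⟨A, -, rfl⟩
  refine Real.sSup_nonneg ?_
  rintro _ ⟨x, -, rfl⟩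
  exact signlessTV_nonneg G x

theorem signlessTV_le_sSup {k : ℕ} {A : Set (V → ℝ)} (hA : A ∈ admissible G k) {x : V → ℝ}
    (hx : x ∈ A) : signlessTV G x ≤ sSup (signlessTV G '' A) := by
  refine le_csSup ⟨1, ?_⟩ (Set.mem_image_of_mem _ hx)
  rintro _ ⟨z, hz, rfl⟩
  exact (signlessTV_le_degreeNorm G z).trans_eq (hA.1 hz)

theorem signlessEigenvalue_le (hdeg : ∀ v, 0 < G.degree v) {k : ℕ} (hk : 1 ≤ k)
    (hkn : k ≤ Fintype.card V) :
    signlessEigenvalue G ⟨k - 1, by omega⟩ ≤ 2 * minMaxEigenvalue G k := by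
  rw [← div_le_iff₀' two_pos]
  -- The family must be nonempty, since the real infimum of ∅ is 0.
  obtain ⟨A₀, hA₀, -⟩ := exists_admissible G hdeg hk hkn
  refine le_csInf ⟨_, A₀, hA₀, rfl⟩ ?_
  rintro _ ⟨A, hA, rfl⟩
  obtain ⟨x, hx, h⟩ := exists_signlessEigenvalue_le G hdeg hk hkn hA
  rw [div_le_iff₀' two_pos]
  have := signlessTV_le_sSup G hA hx
  linarith

theorem minMaxEigenvalue_sq_le (hdeg : ∀ v, 0 < G.degree v) {k : ℕ} (hk : 1 ≤ k)
    (hkn : k ≤ Fintype.card V) :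
    minMaxEigenvalue G k ^ 2 ≤ 2 * signlessEigenvalue G ⟨k - 1, by omega⟩ := by
  obtain ⟨A, hA, h⟩ := exists_admissible G hdeg hk hkn
  -- Only a point of `A` is needed here: it makes the supremum proper and shows μ_k ≥ 0.
  obtain ⟨x, hx, -⟩ := exists_signlessEigenvalue_le G hdeg hk hkn hA
  have h₀ := (sq_nonneg _).trans (h x hx)
  have hle : minMaxEigenvalue G k ≤ √(2 * signlessEigenvalue G ⟨k - 1, by omega⟩) := by
    refine (csInf_le ⟨0, ?_⟩ (Set.mem_image_of_mem _ hA)).trans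
      (csSup_le (Set.Nonempty.image _ ⟨x, hx⟩) ?_)
    · rintro _ ⟨B, -, rfl⟩
      refine Real.sSup_nonneg ?_
      rintro _ ⟨z, -, rfl⟩
      exact signlessTV_nonneg G z
    · rintro _ ⟨z, hz, rfl⟩
      exact Real.le_sqrt_of_sq_le (h z hz)
  exact (pow_le_pow_left₀ (minMaxEigenvalue_nonneg G k) hle 2).trans_eq (Real.sq_sqrt h₀)

end Graph

end SignlessOneLaplacian

theorem mainTheorem3 {V : Type*} [Fintype V] [DecidableEq V] (G : SimpleGraph V)
    [DecidableRel G.Adj] (hdeg : ∀ v, 0 < G.degree v) (k : ℕ) (hk : 1 ≤ k)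
    (hkn : k ≤ Fintype.card V) :
    (SignlessOneLaplacian.minMaxEigenvalue G k) ^ 2 / 2 ≤
        2 - SignlessOneLaplacian.laplacianEigenvalue G (Fintype.card V - k + 1) ∧
      2 - SignlessOneLaplacian.laplacianEigenvalue G (Fintype.card V - k + 1) ≤
        2 * SignlessOneLaplacian.minMaxEigenvalue G k := by
  rw [SignlessOneLaplacian.two_sub_laplacianEigenvalue G hk hkn]
  have h := SignlessOneLaplacian.minMaxEigenvalue_sq_le G hdeg hk hkn
  exact ⟨by linarith, SignlessOneLaplacian.signlessEigenvalue_le G hdeg hk hkn⟩
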